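/- Let $\Sigma$ be a (single-sorted) first-order signature and $T$ a coherent theory over $\Sigma$ in logic without equality, presented by axioms of the form $\forall\vec x.\,(\phi_0\to\exists\vec x_1.\phi_1\lor\dots\lor\exists\vec x_k.\phi_k)$ with each $\phi_i$ a conjunction of atoms. Let $\mathbb C_{ts}$ be the category of conditions $(X;A)$, where $X$ is a finite set of variables and $A$ a finite set of atoms over $X$; a morphism $(Y;B)\to(X;A)$ is a term substitution $f:X\to\mathrm{Tm}(Y)$ with $Af\subseteq B$. Let $\mathbb C_{vs}\subseteq\mathbb C_{ts}$ and $\mathbb C_{rn}\subseteq\mathbb C_{vs}$ be the subcategories with the same objects whose morphisms are the variable substitutions $X\to Y$, respectively the injective variable substitutions (renamings). Let $\mathbb C^0$ be the syntactic site of the theory of equality over $\Sigma$: objects are pairs $(X;A)$ with $X$ a finite set of variables and $A$ a finite set of atoms and equations over $X$; morphisms $(X;A)\to(Y;B)$ are term substitutions $f:Y\to\mathrm{Tm}(X)$ such that the theory of equality together with $A$ proves $Bf$, where $f,g$ are identified if the theory of equality together with $A$ proves $yf=yg$ for all $y\in Y$. Each of these categories carries the Grothendieck topology generated by the inductively defined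 relation $\vartriangleleft_T$: $(X;A)\vartriangleleft_T\{f\}$ for every isomorphism $f$ with codomain $(X;A)$; and $(X;A)\vartriangleleft_T\bigcup_i e_iU_i$ whenever $\phi_0\to\exists\vec x_1.\phi_1\lor\dots\lor\exists\vec x_n.\phi_n$ is an instance over $X$ of an axiom of $T$ with $\phi_0\subseteq A$ (the $\vec x_i$ being fresh for $X$), $(X,\vec x_i;A,\phi_i)\vartriangleleft_T U_i$ for all $i$, and $e_i:(X,\vec x_i;A,\phi_i)\to(X;A)$ is the identity on $X$. The topos $\mathrm{Sh}(\mathbb C^0)$ is the Coste--Coste presentation of the classifying topos $\mathbf{Set}[T]$. The canonical model in $\mathrm{Sh}(\mathbb C_x)$, $x\in\{rn,vs,ts\}$, is the $\Sigma$-structure obtained by applying the associated sheaf functor $\mathbf a$ to the presheaf of terms $\mathrm{Tm}(X;A)=\mathrm{Tm}(X)$, where $f$ sends $(t_1,\dots,t_n)$ to the term $f(t_1,\dots,t_n)$, and $p$ holds of $(t_1,\dots,t_n)$ at $(X;A)$ iff $p(t_1,\dots,t_n)\in A$. The canonical (generic) model in $\mathrm{Sh}(\mathbb C^0)$ is $\mathbf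 a\,\mathbf y(x;)$ with the corresponding structure: $f$ sends classes of terms $t_1,\dots,t_n$ to the class of $f(t_1,\dots,t_n)$, and $p$ holds of the classes of $t_1,\dots,t_n$ at $(X;A)$ iff the theory of equality together with $A$ proves $p(t_1,\dots,t_n)$. **Theorem.** The canonical functors $\mathbb C_{rn}\xrightarrow{i}\mathbb C_{vs}\xrightarrow{j}\mathbb C_{ts}\xrightarrow{k}\mathbb C^0$ are faithful and are comorphisms of sites (they have the covering lifting property). The inverse image functors $F\mapsto\mathbf a(F\circ i^{\mathrm{op}})$, $\mathbf a(F\circ j^{\mathrm{op}})$, $\mathbf a(F\circ k^{\mathrm{op}})$ of the induced geometric morphisms $$\mathrm{Sh}(\mathbb C_{rn})\to\mathrm{Sh}(\mathbb C_{vs})\to\mathrm{Sh}(\mathbb C_{ts})\to\mathrm{Sh}(\mathbb C^0)$$ each send the canonical model to the canonical model, up to isomorphism of $\Sigma$-structures. -/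

import Mathlib

open CategoryTheory CategoryTheory.Limits Opposite

universe u v₁ u₁ v₂ u₂

noncomputable section

namespace SynForcing

/-! ### Atoms and coherent theories -/

/-- An atom `p(t₁,…,tₙ)` without equality, with variables in `α`. -/
structure Atom (L : FirstOrder.Language.{u, u}) (α : Type) : Type u where
  {arity : ℕ}
  rel : L.Relations arity
  args : Fin arity → L.Term α

variable {L : FirstOrder.Language.{u, u}} {α β γ : Type}

/-- Applying a substitution to an atom. -/
def Atom.subst (a : Atom L α) (σ : α → L.Term β) : Atom L β :=
  ⟨a.rel, fun i => (a.args i).subst σ⟩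

theorem term_subst_var (t : L.Term α) : t.subst FirstOrder.Language.Term.var = t := by
  induction t with
  | var => rfl
  | func f ts ih => simp [FirstOrder.Language.Term.subst, ih]

theorem term_subst_subst (t : L.Term α) (σ : α → L.Term β) (τ : β → L.Term γ) :
    (t.subst σ).subst τ = t.subst fun x => (σ x).subst τ := by
  induction t with
  | var => rfl
  | func f ts ih => simp [FirstOrder.Language.Term.subst, ih]

theorem Atom.subst_var (a : Atom L α) : a.subst FirstOrder.Language.Term.var = a := by
  cases a; simp [Atom.subst, term_subst_var]

theorem Atom.subst_subst (a : Atom L α) (σ : α → L.Term β) (τ : β → L.Term γ) :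
    (a.subst σ).subst τ = a.subst fun x => (σ x).subst τ := by
  cases a; simp [Atom.subst, term_subst_subst]

/-- A coherent axiom `∀ x⃗. (φ₀ → ∃ x⃗₁. φ₁ ∨ ⋯ ∨ ∃ x⃗ₖ. φₖ)` without equality, where each `φᵢ` is a
conjunction of atoms, given as the list of its conjuncts. -/
structure CoherentAxiom (L : FirstOrder.Language.{u, u}) : Type u where
  numVars : ℕ
  hyp : List (Atom L (Fin numVars))
  numDisj : ℕ
  numEx : Fin numDisj → ℕ
  concl : ∀ i : Fin numDisj, List (Atom L (Fin numVars ⊕ Fin (numEx i)))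

/-- A coherent theory in logic without equality. -/
abbrev CoherentTheory (L : FirstOrder.Language.{u, u}) := Set (CoherentAxiom L)

/-! ### The categories of conditions -/

/-- A condition `(X;A)`: a finite set `X` of variables (the variables are `x₀, x₁, …`, indexed by
`ℕ`) and a finite set `A` of atoms over `X`. These are the objects of `C_ts`. -/
structure Cond (L : FirstOrder.Language.{u, u}) : Type u where
  vars : Finset ℕ
  facts : Set (Atom L vars)
  finite_facts : facts.Finite

/-- A morphism `(Y;B) ⟶ (X;A)` is a term substitution `X → Tm(Y)` with `Af ⊆ B`. -/
@[ext]
structure Cond.Hom (P Q : Cond L) : Type u where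
  sub : Q.vars → L.Term P.vars
  map_facts : ∀ a ∈ Q.facts, a.subst sub ∈ P.facts

/-- The category `C_ts` of conditions and term substitutions. -/
instance : Category.{u} (Cond L) where
  Hom := Cond.Hom
  id P := ⟨FirstOrder.Language.Term.var, fun a ha => by rwa [Atom.subst_var]⟩
  comp f g := ⟨fun x => (g.sub x).subst f.sub, fun a ha => by
    rw [← Atom.subst_subst]; exact f.map_facts _ (g.map_facts _ ha)⟩
  id_comp f := by
    apply Cond.Hom.ext; funext x; exact term_subst_var _
  comp_id f := by
    apply Cond.Hom.ext; funext x; rfl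
  assoc f g h := by
    apply Cond.Hom.ext; funext x; exact (term_subst_subst _ _ _).symm

/-- The morphisms of `C_ts` that are variable substitutions. -/
def isVarSubst (L : FirstOrder.Language.{u, u}) : MorphismProperty (Cond L) :=
  fun P Q f => ∃ g : Q.vars → P.vars, ∀ x, f.sub x = FirstOrder.Language.Term.var (g x)

instance : (isVarSubst L).IsMultiplicative where
  id_mem P := ⟨id, fun _ => rfl⟩
  comp_mem f g := by
    rintro ⟨f', hf⟩ ⟨g', hg⟩
    refine ⟨fun x => f' (g' x), fun x => ?_⟩
    change (g.sub x).subst f.sub = _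
    rw [hg x]; exact hf _

/-- The category `C_vs` of conditions and variable substitutions. -/
abbrev CondVs (L : FirstOrder.Language.{u, u}) := WideSubcategory (isVarSubst L)

/-- The morphisms of `C_vs` that are renamings, i.e. injective on variables. -/
def isRenaming (L : FirstOrder.Language.{u, u}) : MorphismProperty (CondVs L) :=
  fun _ _ f => Function.Injective f.hom.sub

instance : (isRenaming L).IsMultiplicative where
  id_mem P := fun x y h => by injection h
  comp_mem f g hf hg := by
    obtain ⟨g', hg'⟩ := g.property
    intro x y h
    change (g.hom.sub x).subst f.hom.sub = (g.hom.sub y).subst f.hom.sub at h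
    rw [hg' x, hg' y] at h
    have h2 : g' x = g' y := hf h
    apply hg
    rw [hg' x, hg' y, h2]

/-- The category `C_rn` of conditions and renamings. -/
abbrev CondRn (L : FirstOrder.Language.{u, u}) := WideSubcategory (isRenaming L)

/-- The inclusion `i : C_rn ⥤ C_vs`. -/
abbrev rnToVs (L : FirstOrder.Language.{u, u}) : CondRn L ⥤ CondVs L := wideSubcategoryInclusion _

/-- The inclusion `j : C_vs ⥤ C_ts`. -/
abbrev vsToTs (L : FirstOrder.Language.{u, u}) : CondVs L ⥤ Cond L := wideSubcategoryInclusion _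

/-! ### The syntactic site of the theory of equality -/

/-- A fact over `α`: an atom of the signature or an equation between terms. -/
inductive EqFact (L : FirstOrder.Language.{u, u}) (α : Type) : Type u
  | atom (a : Atom L α) : EqFact L α
  | eq (s t : L.Term α) : EqFact L α

/-- Applying a substitution to a fact. -/
def EqFact.subst (σ : α → L.Term β) : EqFact L α → EqFact L β
  | .atom a => .atom (a.subst σ)
  | .eq s t => .eq (s.subst σ) (t.subst σ)

theorem EqFact.subst_var (a : EqFact L α) : a.subst FirstOrder.Language.Term.var = a := by
  cases a <;> simp [EqFact.subst, Atom.subst_var, term_subst_var]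

theorem EqFact.subst_subst (a : EqFact L α) (σ : α → L.Term β) (τ : β → L.Term γ) :
    (a.subst σ).subst τ = a.subst fun x => (σ x).subst τ := by
  cases a <;> simp [EqFact.subst, Atom.subst_subst, term_subst_subst]

/-- `Entails A φ`: the theory of equality (a strict universal Horn theory, whose axioms say that `=`
is a congruence for the signature) together with the facts in `A` proves the fact `φ`. -/
inductive Entails (A : Set (EqFact L α)) : EqFact L α → Prop
  | hyp {φ : EqFact L α} : φ ∈ A → Entails A φ
  | refl (t : L.Term α) : Entails A (.eq t t)
  | symm {s t : L.Term α} : Entails A (.eq s t) → Entails A (.eq t s)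
  | trans {r s t : L.Term α} : Entails A (.eq r s) → Entails A (.eq s t) → Entails A (.eq r t)
  | func {n : ℕ} (f : L.Functions n) {s t : Fin n → L.Term α} :
      (∀ i, Entails A (.eq (s i) (t i))) →
        Entails A (.eq (FirstOrder.Language.Term.func f s) (FirstOrder.Language.Term.func f t))
  | rel {n : ℕ} (p : L.Relations n) {s t : Fin n → L.Term α} :
      (∀ i, Entails A (.eq (s i) (t i))) → Entails A (.atom ⟨p, s⟩) → Entails A (.atom ⟨p, t⟩)

theorem Entails.subst {A : Set (EqFact L α)} {B : Set (EqFact L β)} {σ : α → L.Term β}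
    (h : ∀ a ∈ A, Entails B (a.subst σ)) {φ : EqFact L α} (hφ : Entails A φ) :
    Entails B (φ.subst σ) := by
  induction hφ with
  | hyp ha => exact h _ ha
  | refl t => exact .refl _
  | symm _ ih => exact .symm ih
  | trans _ _ ih₁ ih₂ => exact .trans ih₁ ih₂
  | func f _ ih => exact .func f ih
  | rel p _ _ ih₁ ih₂ => exact .rel p ih₁ ih₂

theorem Entails.subst_eq {B : Set (EqFact L β)} {σ τ : α → L.Term β}
    (h : ∀ x, Entails B (.eq (σ x) (τ x))) (t : L.Term α) :
    Entails B (.eq (t.subst σ) (t.subst τ)) := by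
  induction t with
  | var x => exact h x
  | func f ts ih => exact .func f ih

/-- The objects `(X;A)` of the syntactic site `C⁰`: now `A` may also contain equations. -/
structure CondEq (L : FirstOrder.Language.{u, u}) : Type u where
  vars : Finset ℕ
  facts : Set (EqFact L vars)
  finite_facts : facts.Finite

/-- The term substitutions `f : Y → Tm(X)` such that equality theory with `A` proves `Bf`. -/
structure CondEq.PreHom (P Q : CondEq L) : Type u where
  sub : Q.vars → L.Term P.vars
  map_facts : ∀ a ∈ Q.facts, Entails P.facts (a.subst sub)

/-- Two substitutions are identified if they are provably equal. -/
instance CondEq.setoid (P Q : CondEq L) : Setoid (CondEq.PreHom P Q) where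
  r f g := ∀ y, Entails P.facts (.eq (f.sub y) (g.sub y))
  iseqv := ⟨fun _ _ => .refl _, fun h y => .symm (h y), fun h k y => .trans (h y) (k y)⟩

/-- The identity substitution. -/
def CondEq.preId (P : CondEq L) : CondEq.PreHom P P :=
  ⟨FirstOrder.Language.Term.var, fun a ha => by rw [EqFact.subst_var]; exact .hyp ha⟩

/-- Composition of substitutions. -/
def CondEq.preComp {P Q R : CondEq L} (f : CondEq.PreHom P Q) (g : CondEq.PreHom Q R) :
    CondEq.PreHom P R :=
  ⟨fun x => (g.sub x).subst f.sub, fun a ha => by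
    rw [← EqFact.subst_subst]; exact Entails.subst f.map_facts (g.map_facts a ha)⟩

/-- The syntactic site `C⁰` of the theory of equality in the signature. -/
instance : Category.{u} (CondEq L) where
  Hom P Q := Quotient (CondEq.setoid P Q)
  id P := Quotient.mk _ P.preId
  comp {_ Q _} f g := Quotient.map₂ CondEq.preComp (fun f f' hf g g' hg x =>
    (Entails.subst_eq hf (g.sub x)).trans
      (Entails.subst f'.map_facts ((show ∀ y, Entails Q.facts (.eq (g.sub y) (g'.sub y)) from hg) x)))
    f g
  id_comp f := by
    induction f using Quotient.inductionOn with | _ f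
    refine Quotient.sound fun x => ?_
    change Entails _ (.eq ((f.sub x).subst FirstOrder.Language.Term.var) _)
    rw [term_subst_var]; exact .refl _
  comp_id f := by
    induction f using Quotient.inductionOn with | _ f
    exact Quotient.sound fun x => .refl _
  assoc f g h := by
    induction f using Quotient.inductionOn with | _ f
    induction g using Quotient.inductionOn with | _ g
    induction h using Quotient.inductionOn with | _ h
    refine Quotient.sound fun x => ?_
    change Entails _ (.eq ((h.sub x).subst fun y => (g.sub y).subst f.sub)
      (((h.sub x).subst g.sub).subst f.sub))
    rw [term_subst_subst]; exact .refl _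

/-- A condition without equality, regarded as an object of `C⁰`. -/
def Cond.toEq (P : Cond L) : CondEq L :=
  ⟨P.vars, EqFact.atom '' P.facts, P.finite_facts.image _⟩

/-- The canonical functor `k : C_ts ⥤ C⁰`. -/
def tsToEq (L : FirstOrder.Language.{u, u}) : Cond L ⥤ CondEq L where
  obj P := P.toEq
  map {P Q} f := Quotient.mk (CondEq.setoid P.toEq Q.toEq) ⟨f.sub, by
    rintro _ ⟨a, ha, rfl⟩
    exact .hyp ⟨_, f.map_facts a ha, rfl⟩⟩
  map_id _ := rfl
  map_comp _ _ := rfl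

/-! ### The coverages -/

/-- An instance over the variables `X` of an axiom
`∀ x⃗. (φ₀ → ∃ x⃗₁. φ₁ ∨ ⋯ ∨ ∃ x⃗ₖ. φₖ)` of `T`: terms over `X` for `x⃗`, and names for the bound
variables `x⃗ᵢ` that are pairwise distinct and not in `X`. -/
structure AxiomInstance (T : CoherentTheory L) (X : Finset ℕ) : Type u where
  ax : CoherentAxiom L
  mem : ax ∈ T
  inst : Fin ax.numVars → L.Term X
  fresh : ∀ i : Fin ax.numDisj, Fin (ax.numEx i) ↪ ℕ
  fresh_notMem : ∀ i x, fresh i x ∉ X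

namespace AxiomInstance

variable {T : CoherentTheory L} {X : Finset ℕ} (I : AxiomInstance T X)

/-- The atoms of the instance of `φ₀`. -/
def hyp : Set (Atom L X) := {a | ∃ b ∈ I.ax.hyp, a = b.subst I.inst}

/-- The set of variables `X, x⃗ᵢ`. -/
def vars (i : Fin I.ax.numDisj) : Finset ℕ := X ∪ Finset.univ.map (I.fresh i)

/-- The substitution that is the identity on `X`, from `X` to terms over `X, x⃗ᵢ`. -/
def incl (i : Fin I.ax.numDisj) (x : X) : L.Term (I.vars i) :=
  FirstOrder.Language.Term.var ⟨x, Finset.mem_union_left _ x.2⟩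

theorem incl_injective (i : Fin I.ax.numDisj) : Function.Injective (I.incl i) := by
  intro x y h
  injection h with h
  exact Subtype.ext (Subtype.mk.inj h)

/-- The instantiation of the variables of `φᵢ`. -/
def conclInst (i : Fin I.ax.numDisj) :
    Fin I.ax.numVars ⊕ Fin (I.ax.numEx i) → L.Term (I.vars i)
  | .inl j => (I.inst j).subst (I.incl i)
  | .inr j => FirstOrder.Language.Term.var ⟨I.fresh i j,
      Finset.mem_union_right _ (Finset.mem_map_of_mem _ (Finset.mem_univ j))⟩

/-- The atoms of the instance of `φᵢ`. -/
def concl (i : Fin I.ax.numDisj) : Set (Atom L (I.vars i)) :=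
  {a | ∃ b ∈ I.ax.concl i, a = b.subst (I.conclInst i)}

theorem finite_concl (i : Fin I.ax.numDisj) : (I.concl i).Finite := by
  refine ((List.finite_toSet (I.ax.concl i)).image
    fun b => b.subst (I.conclInst i)).subset ?_
  rintro a ⟨b, hb, rfl⟩
  exact ⟨b, hb, rfl⟩

/-- The condition `(X, x⃗ᵢ; A, φᵢ)`. -/
def ext {P : Cond L} (I : AxiomInstance T P.vars) (i : Fin I.ax.numDisj) : Cond L where
  vars := I.vars i
  facts := (fun a => a.subst (I.incl i)) '' P.facts ∪ I.concl i
  finite_facts := (P.finite_facts.image _).union (I.finite_concl i)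

/-- The morphism `eᵢ : (X, x⃗ᵢ; A, φᵢ) ⟶ (X;A)`, the identity on `X`. -/
def proj {P : Cond L} (I : AxiomInstance T P.vars) (i : Fin I.ax.numDisj) : I.ext i ⟶ P :=
  Cond.Hom.mk (P := I.ext i) (I.incl i) fun a ha => Or.inl ⟨a, ha, rfl⟩

/-- The object `(X, x⃗ᵢ; A, φᵢ)` of `C⁰`. -/
def extEq {P : CondEq L} (I : AxiomInstance T P.vars) (i : Fin I.ax.numDisj) : CondEq L where
  vars := I.vars i
  facts := EqFact.subst (I.incl i) '' P.facts ∪ EqFact.atom '' I.concl i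
  finite_facts := (P.finite_facts.image _).union ((I.finite_concl i).image _)

/-- The morphism `eᵢ : (X, x⃗ᵢ; A, φᵢ) ⟶ (X;A)` of `C⁰`. -/
def projEq {P : CondEq L} (I : AxiomInstance T P.vars) (i : Fin I.ax.numDisj) : I.extEq i ⟶ P :=
  Quotient.mk (CondEq.setoid (I.extEq i) P)
    ⟨I.incl i, fun a ha => .hyp (Or.inl ⟨a, ha, rfl⟩)⟩

end AxiomInstance

/-- For every object `X` of `C`, a collection of finite families of morphisms with codomain `X`. -/
structure Families (C : Type u₁) [Category.{v₁} C] where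
  index : C → Type u
  card : ∀ {X : C}, index X → ℕ
  obj : ∀ {X : C} (a : index X), Fin (card a) → C
  hom : ∀ {X : C} (a : index X) (i : Fin (card a)), obj a i ⟶ X

/-- The relation `X ◁ U` inductively generated from families `eᵢ : Xᵢ ⟶ X`: every isomorphism with
codomain `X` covers `X`, and if `Xᵢ ◁ Uᵢ` for all `i`, then `X ◁ ⋃ᵢ eᵢ Uᵢ`. -/
inductive Covers {C : Type u₁} [Category.{v₁} C] (E : Families.{u} C) : ∀ X : C, Presieve X → Prop
  | iso {X Y : C} (f : Y ⟶ X) (hf : IsIso f) : Covers E X (Presieve.singleton f)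
  | step {X : C} (a : E.index X) (U : ∀ i, Presieve (E.obj a i))
      (hU : ∀ i, Covers E (E.obj a i) (U i)) :
      Covers E X (Presieve.bindOfArrows (E.obj a) (E.hom a) U)

/-- The Grothendieck topology generated by the relation `◁`. -/
def Families.topology {C : Type u₁} [Category.{v₁} C] (E : Families.{u} C) :
    GrothendieckTopology C :=
  Precoverage.toGrothendieck ⟨fun X => {U | Covers E X U}⟩

/-- The families `{eᵢ : (X, x⃗ᵢ; A, φᵢ) ⟶ (X;A)}` in `C_ts`, for the instances over `X` of axioms of
`T` with `φ₀ ⊆ A`. -/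
def familiesTs (T : CoherentTheory L) : Families.{u} (Cond L) where
  index P := {I : AxiomInstance T P.vars // I.hyp ⊆ P.facts}
  card I := I.1.ax.numDisj
  obj I i := I.1.ext i
  hom I i := I.1.proj i

/-- The same families in `C_vs`. -/
def familiesVs (T : CoherentTheory L) : Families.{u} (CondVs L) where
  index P := {I : AxiomInstance T P.obj.vars // I.hyp ⊆ P.obj.facts}
  card I := I.1.ax.numDisj
  obj I i := ⟨I.1.ext i⟩
  hom I i := ⟨I.1.proj i, fun x => ⟨x, Finset.mem_union_left _ x.2⟩, fun _ => rfl⟩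

/-- The same families in `C_rn`. -/
def familiesRn (T : CoherentTheory L) : Families.{u} (CondRn L) where
  index P := {I : AxiomInstance T P.obj.obj.vars // I.hyp ⊆ P.obj.obj.facts}
  card I := I.1.ax.numDisj
  obj I i := ⟨⟨I.1.ext i⟩⟩
  hom I i := ⟨⟨I.1.proj i, fun x => ⟨x, Finset.mem_union_left _ x.2⟩, fun _ => rfl⟩,
    I.1.incl_injective i⟩

/-- The corresponding families in `C⁰`. -/
def familiesEq (T : CoherentTheory L) : Families.{u} (CondEq L) where
  index P := {I : AxiomInstance T P.vars // EqFact.atom '' I.hyp ⊆ P.facts}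
  card I := I.1.ax.numDisj
  obj I i := I.1.extEq i
  hom I i := I.1.projEq i

/-- The topology on `C_rn` given by `T`. -/
abbrev topRn (T : CoherentTheory L) : GrothendieckTopology (CondRn L) := (familiesRn T).topology

/-- The topology on `C_vs` given by `T`. -/
abbrev topVs (T : CoherentTheory L) : GrothendieckTopology (CondVs L) := (familiesVs T).topology

/-- The topology on `C_ts` given by `T`. -/
abbrev topTs (T : CoherentTheory L) : GrothendieckTopology (Cond L) := (familiesTs T).topology

/-- The topology on `C⁰` given by `T`. -/
abbrev topEq (T : CoherentTheory L) : GrothendieckTopology (CondEq L) := (familiesEq T).topology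

/-! ### Structures for a signature in a category with finite limits -/

/-- A structure for the signature `L` in `E`: a carrier `M`, a morphism `Mⁿ ⟶ M` for every `n`-ary
function symbol, and a subobject of `Mⁿ` for every `n`-ary predicate symbol. -/
structure SigStr (L : FirstOrder.Language.{u, u}) (E : Type u₁) [Category.{v₁} E] [HasFiniteLimits E] where
  carrier : E
  funMap : ∀ {n : ℕ}, L.Functions n → ((∏ᶜ fun _ : Fin n => carrier) ⟶ carrier)
  rel : ∀ {n : ℕ}, L.Relations n → Subobject (∏ᶜ fun _ : Fin n => carrier)

section

variable {E : Type u₁} [Category.{v₁} E] [HasFiniteLimits E]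
variable {F : Type u₂} [Category.{v₂} F] [HasFiniteLimits F]

/-- A homomorphism of structures: a morphism of carriers that respects the interpretations of the
function and predicate symbols. -/
@[ext]
structure SigStr.Hom (M N : SigStr L E) where
  hom : M.carrier ⟶ N.carrier
  map_fun : ∀ {n : ℕ} (f : L.Functions n),
    M.funMap f ≫ hom = Limits.Pi.map (fun _ => hom) ≫ N.funMap f
  map_rel : ∀ {n : ℕ} (p : L.Relations n),
    (N.rel p).Factors ((M.rel p).arrow ≫ Limits.Pi.map fun _ => hom)

/-- The category of structures and homomorphisms. -/
instance : Category (SigStr L E) where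
  Hom := SigStr.Hom
  id M := ⟨𝟙 _, fun f => by simp, fun p => by
    simpa using Subobject.factors_comp_arrow (P := M.rel p) (𝟙 _)⟩
  comp {M N K} g h := ⟨g.hom ≫ h.hom, fun f => by
    rw [← Category.assoc, g.map_fun, Category.assoc, h.map_fun, ← Category.assoc,
      Limits.Pi.map_comp_map], fun p => by
    have e : (M.rel p).arrow ≫ Limits.Pi.map (fun _ => g.hom ≫ h.hom) =
        (N.rel p).factorThru _ (g.map_rel p) ≫ (N.rel p).arrow ≫ Limits.Pi.map fun _ => h.hom := by
      rw [← Category.assoc, Subobject.factorThru_arrow, Category.assoc, Limits.Pi.map_comp_map]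
    rw [e]
    exact Subobject.factors_of_factors_right _ (h.map_rel p)⟩

/-- The image of a structure under a functor `G` preserving finite limits, using the canonical
isomorphisms `G(Mⁿ) ≅ G(M)ⁿ`. -/
def SigStr.map (G : E ⥤ F) [PreservesFiniteLimits G] (M : SigStr L E) : SigStr L F where
  carrier := G.obj M.carrier
  funMap {n} f := inv (piComparison G fun _ : Fin n => M.carrier) ≫ G.map (M.funMap f)
  rel {n} p := Subobject.mk (G.map (M.rel p).arrow ≫ piComparison G fun _ : Fin n => M.carrier)

/-- A geometric morphism `E → F`. -/
structure GeomMorphism (E : Type u₁) [Category.{v₁} E] (F : Type u₂) [Category.{v₂} F] where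
  inverseImage : F ⥤ E
  directImage : E ⥤ F
  adj : inverseImage ⊣ directImage
  preservesFiniteLimits : PreservesFiniteLimits inverseImage

attribute [instance] GeomMorphism.preservesFiniteLimits

end

/-- The geometric morphism `Sh(C) → Sh(D)` induced by a comorphism of sites `F : C ⥤ D`. Its inverse
image functor sends a sheaf on `D` to the sheaf associated with its restriction along `F`; its direct
image functor is the right Kan extension along `F`. -/
def comorphismGeom {C D : Type u} [Category.{u} C] [Category.{u} D] (F : C ⥤ D)
    (J : GrothendieckTopology C) (K : GrothendieckTopology D) (hF : F.IsCocontinuous J K) :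
    GeomMorphism (Sheaf J (Type u)) (Sheaf K (Type u)) where
  inverseImage := sheafToPresheaf K (Type u) ⋙ (Functor.whiskeringLeft _ _ _).obj F.op ⋙
    presheafToSheaf J (Type u)
  directImage := F.sheafPushforwardCocontinuous (Type u) J K
  adj := ((F.op.ranAdjunction (Type u)).comp (sheafificationAdjunction J (Type u))).restrictFullyFaithful
    (fullyFaithfulSheafToPresheaf K (Type u)) (Functor.FullyFaithful.id _) (Iso.refl _) (Iso.refl _)
  preservesFiniteLimits := inferInstance

/-! ### The canonical models -/

/-- The structure in presheaves on `C` with carrier `P` whose function symbols are interpreted by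
`op` and whose predicate symbols are interpreted by `rel`, objectwise. -/
def presheafStr {C : Type u} [Category.{u} C] (P : Cᵒᵖ ⥤ Type u)
    (op : ∀ {n : ℕ}, L.Functions n → ∀ X, (Fin n → P.obj X) → P.obj X)
    (op_natural : ∀ {n : ℕ} (f : L.Functions n) {X Y} (g : X ⟶ Y) (t : Fin n → P.obj X),
      P.map g (op f X t) = op f Y fun i => P.map g (t i))
    (rel : ∀ {n : ℕ}, L.Relations n → ∀ X, Set (Fin n → P.obj X))
    (rel_stable : ∀ {n : ℕ} (p : L.Relations n) {X Y} (g : X ⟶ Y) (t : Fin n → P.obj X),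
      t ∈ rel p X → (fun i => P.map g (t i)) ∈ rel p Y) :
    SigStr L (Cᵒᵖ ⥤ Type u) where
  carrier := P
  funMap {n} f :=
    { app X := TypeCat.ofHom fun z => op f X fun i => (Pi.π (fun _ : Fin n => P) i).app X z
      naturality X Y g := by
        ext z
        simp [op_natural] }
  rel {n} p := Subobject.mk (Subfunctor.ι
    { obj X := {z : (∏ᶜ fun _ : Fin n => P).obj X |
        (fun i => (Pi.π (fun _ : Fin n => P) i).app X z) ∈ rel p X}
      map {X Y} g := by
        intro z hz
        have := rel_stable p g _ hz
        simpa using! this })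

/-- The presheaf of terms on `C_ts`, `Tm(X;A) = Tm(X)`, as a structure: `f` sends `t₁,…,tₙ` to the
term `f(t₁,…,tₙ)`, and `p` holds of `t₁,…,tₙ` at `(X;A)` iff `p(t₁,…,tₙ) ∈ A`. -/
def tmTs (L : FirstOrder.Language.{u, u}) : SigStr L ((Cond L)ᵒᵖ ⥤ Type u) :=
  presheafStr
    { obj X := L.Term X.unop.vars
      map g := TypeCat.ofHom fun t => t.subst g.unop.sub
      map_id X := by ext t; exact term_subst_var t
      map_comp g h := by ext t; exact (term_subst_subst _ _ _).symm }
    (fun f _ t => FirstOrder.Language.Term.func f t) (fun _ _ _ _ _ => rfl)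
    (fun p X => {t | Atom.mk p t ∈ X.unop.facts}) (fun p _ _ g t ht => g.unop.map_facts ⟨p, t⟩ ht)

/-- The presheaf of terms on `C_vs`, as a structure. -/
def tmVs (L : FirstOrder.Language.{u, u}) : SigStr L ((CondVs L)ᵒᵖ ⥤ Type u) :=
  presheafStr
    { obj X := L.Term X.unop.obj.vars
      map g := TypeCat.ofHom fun t => t.subst g.unop.hom.sub
      map_id X := by ext t; exact term_subst_var t
      map_comp g h := by ext t; exact (term_subst_subst _ _ _).symm }
    (fun f _ t => FirstOrder.Language.Term.func f t) (fun _ _ _ _ _ => rfl)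
    (fun p X => {t | Atom.mk p t ∈ X.unop.obj.facts}) (fun p _ _ g t ht => g.unop.hom.map_facts ⟨p, t⟩ ht)

/-- The presheaf of terms on `C_rn`, as a structure. -/
def tmRn (L : FirstOrder.Language.{u, u}) : SigStr L ((CondRn L)ᵒᵖ ⥤ Type u) :=
  presheafStr
    { obj X := L.Term X.unop.obj.obj.vars
      map g := TypeCat.ofHom fun t => t.subst g.unop.hom.hom.sub
      map_id X := by ext t; exact term_subst_var t
      map_comp g h := by ext t; exact (term_subst_subst _ _ _).symm }
    (fun f _ t => FirstOrder.Language.Term.func f t) (fun _ _ _ _ _ => rfl)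
    (fun p X => {t | Atom.mk p t ∈ X.unop.obj.obj.facts})
    (fun p _ _ g t ht => g.unop.hom.hom.map_facts ⟨p, t⟩ ht)

/-- The object `(x;)` of `C⁰`, with `x = x₀`. -/
def pointEq (L : FirstOrder.Language.{u, u}) : CondEq L := ⟨{0}, ∅, Set.finite_empty⟩

/-- The morphism `[x := t] : (X;A) ⟶ (x;)` of `C⁰` given by a term `t` over `X`. -/
def termHom {P : CondEq L} (t : L.Term P.vars) : P ⟶ pointEq L :=
  Quotient.mk (CondEq.setoid P (pointEq L)) ⟨fun _ => t, fun _ ha => ha.elim⟩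

/-- A term representing a morphism `(X;A) ⟶ (x;)` of `C⁰`. -/
def termOf {P : CondEq L} (f : P ⟶ pointEq L) : L.Term P.vars :=
  (Quotient.out (s := CondEq.setoid P (pointEq L)) f).sub ⟨0, Finset.mem_singleton_self 0⟩

theorem termHom_termOf {P : CondEq L} (f : P ⟶ pointEq L) : termHom (termOf f) = f := by
  refine Eq.trans (Quotient.sound fun y => ?_) (Quotient.out_eq (s := CondEq.setoid P (pointEq L)) f)
  obtain ⟨y, hy⟩ := y
  obtain rfl := Finset.mem_singleton.1 hy
  exact .refl _

theorem termHom_eq_iff {P : CondEq L} {s t : L.Term P.vars} :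
    termHom s = termHom t ↔ Entails P.facts (.eq s t) :=
  ⟨fun h => Quotient.exact h ⟨0, Finset.mem_singleton_self 0⟩, fun h => Quotient.sound fun _ => h⟩

theorem comp_termHom {P Q : CondEq L} (g : CondEq.PreHom P Q) (t : L.Term Q.vars) :
    (Quotient.mk (CondEq.setoid P Q) g : P ⟶ Q) ≫ termHom t = termHom (t.subst g.sub) := rfl

/-- The presheaf represented by `(x;)` on `C⁰`, as a structure: `f` sends the classes of `t₁,…,tₙ` to
the class of `f(t₁,…,tₙ)`, and `p` holds of the classes of `t₁,…,tₙ` at `(X;A)` iff the theory of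
equality together with `A` proves `p(t₁,…,tₙ)`. -/
def yoPoint (L : FirstOrder.Language.{u, u}) : SigStr L ((CondEq L)ᵒᵖ ⥤ Type u) :=
  presheafStr (yoneda.obj (pointEq L))
    (fun f _ t => termHom (FirstOrder.Language.Term.func f fun i => termOf (t i)))
    (fun f X Y g t => by
      obtain ⟨g⟩ := g
      induction g using Quotient.inductionOn with | _ g
      refine termHom_eq_iff.2 (.func f fun i => termHom_eq_iff.1 ?_)
      rw [termHom_termOf, ← comp_termHom, termHom_termOf]
      rfl)
    (fun p X => {t | ∃ s, (∀ i, t i = termHom (s i)) ∧ Entails X.unop.facts (.atom ⟨p, s⟩)})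
    (fun p X Y g t ⟨s, hs, hp⟩ => by
      obtain ⟨g⟩ := g
      induction g using Quotient.inductionOn with | _ g
      refine ⟨fun i => (s i).subst g.sub, fun i => ?_, Entails.subst g.map_facts hp⟩
      beta_reduce
      rw [hs i]
      rfl)

/-- The canonical model in `Sh(C_rn)`: the sheaf associated with the presheaf of terms. -/
def canonRn (T : CoherentTheory L) : SigStr L (Sheaf (topRn T) (Type u)) :=
  (tmRn L).map (presheafToSheaf (topRn T) (Type u))

/-- The canonical model in `Sh(C_vs)`. -/
def canonVs (T : CoherentTheory L) : SigStr L (Sheaf (topVs T) (Type u)) :=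
  (tmVs L).map (presheafToSheaf (topVs T) (Type u))

/-- The canonical model in `Sh(C_ts)`. -/
def canonTs (T : CoherentTheory L) : SigStr L (Sheaf (topTs T) (Type u)) :=
  (tmTs L).map (presheafToSheaf (topTs T) (Type u))

/-- The canonical (generic) model in `Sh(C⁰)`: the sheaf associated with the presheaf represented by
`(x;)`. -/
def canonEq (T : CoherentTheory L) : SigStr L (Sheaf (topEq T) (Type u)) :=
  (yoPoint L).map (presheafToSheaf (topEq T) (Type u))

end SynForcing

end

noncomputable section

namespace SynForcing

/-! ### Cover lifting for inductively generated topologies -/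

section CoverLifting

variable {C : Type u₁} [Category.{v₁} C] {D : Type u₂} [Category.{v₂} D]

/-! On conditions all three functors are the identity; a condition of `C_ts` is read in `C⁰` as one
without equations. All four topologies are generated by instances of the same axioms. A substitution
`X → Tm(Y)` carries an instance over `X` to one over `Y`, with new names for the bound variables,
and it extends to these variables (`AxiomInstance.reindex`, `AxiomInstance.liftSub`). So a
generating family, pulled back along a morphism of the larger category, is refined by a generating
family of the smaller one. An induction over the generation of the topology turns this into cover
lifting (`Families.isCocontinuous`).

The step to `C⁰` also needs that atoms prove only themselves and trivial equations
(`Entails.of_atoms`). This gives faithfulness, puts the hypotheses of a pulled-back instance into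
the condition itself, and makes the presheaf represented by `(x;)` restrict to the presheaf of
terms.

For the models, sheafifying and then taking the inverse image agrees with restricting and then
sheafifying, since both composites are left adjoint to the same functor (`sheafifyInverseImageIso`).
All functors involved preserve finite limits, hence act on structures, so it suffices to compare the
structures at the level of presheaves (`presheafStrRestrictIso`). -/

/-- Every generating family covers. -/
theorem Families.generate_mem_topology (E : Families.{u} C) {X : C} (a : E.index X) :
    Sieve.generate (Presieve.ofArrows (E.obj a) (E.hom a)) ∈ E.topology X := by
  refine E.topology.superset_covering ?_
    (Precoverage.generate_mem_toGrothendieck (J := ⟨fun X => {U | Covers E X U}⟩)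
      -- Covering each member by its identity, a single inductive step yields the family itself, up
      -- to composition with identities.
      (Covers.step a (fun i => Presieve.singleton (𝟙 _)) fun i => .iso _ inferInstance))
  rw [Sieve.generate_le_iff]
  rintro _ _ ⟨i, g, hg⟩
  obtain ⟨⟩ := hg
  exact ⟨_, 𝟙 _, _, ⟨i⟩, by simp⟩

/-- A functor into a site generated by families is a comorphism of sites if it lifts the
generating families, pulled back along any morphism from an object in its image. -/
theorem Families.isCocontinuous (F : C ⥤ D) (J : GrothendieckTopology C) (E : Families.{u} D)
    (h : ∀ (c : C) (d : D) (g : F.obj c ⟶ d) (a : E.index d),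
      ((Sieve.generate (Presieve.ofArrows (E.obj a) (E.hom a))).pullback g).functorPullback F ∈ J c) :
    F.IsCocontinuous J E.topology := by
  -- The claim is made for every `g`, not only for identities: the lifts `m` in the `step` case are
  -- arbitrary morphisms of `D` out of the image of `F`.
  have gen : ∀ (d : D) (U : Presieve d), Covers E d U → ∀ (c : C) (g : F.obj c ⟶ d),
      ((Sieve.generate U).pullback g).functorPullback F ∈ J c := by
    intro d U hU
    induction hU with
    | iso f hf =>
      intro c g
      refine J.superset_covering ?_ (J.top_mem c)
      intro c' k _
      exact ⟨_, (F.map k ≫ g) ≫ inv f, f, ⟨⟩, by simp⟩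
    | step a U _ ih =>
      intro c g
      -- By `h`, the morphisms whose image lifts through some `eᵢ` cover `c`; along such a lift `m`
      -- the induction hypothesis covers further.
      refine J.transitive (h c _ g a) _ ?_
      rintro c' k ⟨_, m, _, ⟨i⟩, hm⟩
      refine J.superset_covering ?_ (ih i c' m)
      rintro c'' l ⟨_, n, q, hq, hn⟩
      refine ⟨_, n, _, ⟨i, q, hq⟩, ?_⟩
      rw [reassoc_of% hn, hm, F.map_comp, Category.assoc]
  have key : ∀ (d : D) (S : Sieve d), S ∈ E.topology d → ∀ (c : C) (g : F.obj c ⟶ d),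
      (S.pullback g).functorPullback F ∈ J c := by
    intro d S hS
    induction hS with
    | of d U hU => exact gen d U hU
    | top =>
      intro c g
      rw [Sieve.pullback_top]
      exact J.superset_covering (fun _ _ _ => trivial) (J.top_mem c)
    -- Immediate because of the quantification over `g`: pull back along `g ≫ f` instead.
    | pullback d S _ d' f ih =>
      intro c g
      rw [← Sieve.pullback_comp]
      exact ih c _
    | transitive d S R _ _ ihS ihR =>
      intro c g
      refine J.transitive (ihS c g) _ ?_
      intro c' k hk
      refine J.superset_covering ?_ (ihR hk c' (𝟙 _))
      intro c'' l hl
      change R.arrows (F.map (l ≫ k) ≫ g)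
      rw [F.map_comp, Category.assoc]
      simpa using hl
  exact ⟨fun {c S} hS => by simpa using key _ S hS c (𝟙 _)⟩

end CoverLifting

/-! ### Functoriality of the image of a structure -/

section

variable {L : FirstOrder.Language.{u, u}}
variable {E : Type u₁} [Category.{v₁} E] [HasFiniteLimits E]
variable {F : Type u₂} [Category.{v₂} F] [HasFiniteLimits F]

omit [HasFiniteLimits E] in
theorem factors_mk_of_comp_eq {A B X : E} (m : A ⟶ X) [Mono m] {f : B ⟶ X} (g : B ⟶ A)
    (h : g ≫ m = f) : (Subobject.mk m).Factors f :=
  ⟨g, h⟩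

omit [HasFiniteLimits E] in
/-- A morphism out of a subobject factors through `mk n` if it does so on a representative. -/
theorem factors_mk_arrow_comp {A B X Y : E} (m : A ⟶ X) [Mono m] (n : B ⟶ Y) [Mono n]
    {f : X ⟶ Y} (g : A ⟶ B) (h : g ≫ n = m ≫ f) :
    (Subobject.mk n).Factors ((Subobject.mk m).arrow ≫ f) :=
  factors_mk_of_comp_eq n ((Subobject.underlyingIso m).hom ≫ g) (by
    rw [Category.assoc, h, Subobject.underlyingIso_hom_comp_eq_mk_assoc])

theorem SigStr.comp_hom {M N K : SigStr L E} (f : M ⟶ N) (g : N ⟶ K) :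
    SigStr.Hom.hom (f ≫ g) = SigStr.Hom.hom f ≫ SigStr.Hom.hom g := rfl

/-- Structures are isomorphic if there is an isomorphism of carriers that is, in both directions,
a homomorphism. -/
def SigStr.isoMk {M N : SigStr L E} (e : M.carrier ≅ N.carrier)
    (hfun : ∀ {n : ℕ} (f : L.Functions n),
      M.funMap f ≫ e.hom = Limits.Pi.map (fun _ => e.hom) ≫ N.funMap f)
    (hrel : ∀ {n : ℕ} (p : L.Relations n),
      (N.rel p).Factors ((M.rel p).arrow ≫ Limits.Pi.map fun _ => e.hom))
    (hrel' : ∀ {n : ℕ} (p : L.Relations n),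
      (M.rel p).Factors ((N.rel p).arrow ≫ Limits.Pi.map fun _ => e.inv)) : M ≅ N where
  hom := SigStr.Hom.mk (M := M) (N := N) e.hom hfun hrel
  -- Compatibility of the inverse with operations follows by cancelling `e.hom`. For relations there
  -- is no such argument, hence the separate assumption `hrel'`.
  inv := SigStr.Hom.mk (M := N) (N := M) e.inv (fun {n} f => by
    have h : Limits.Pi.map (fun _ : Fin n => e.inv) ≫ Limits.Pi.map (fun _ : Fin n => e.hom) =
        𝟙 _ := by
      rw [Limits.Pi.map_comp_map]; simp
    rw [← cancel_mono e.hom, Category.assoc, Category.assoc, hfun, reassoc_of% h]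
    simp) hrel'
  hom_inv_id := SigStr.Hom.ext e.hom_inv_id
  inv_hom_id := SigStr.Hom.ext e.inv_hom_id

/-! ### Naturality of the comparison maps `G(Aⁿ) ⟶ G(A)ⁿ`. -/

section

variable (G : E ⥤ F) {n : ℕ}

theorem map_piMap_comp_piComparison {A B : E} (h : A ⟶ B) :
    G.map (Limits.Pi.map fun _ : Fin n => h) ≫ piComparison G (fun _ : Fin n => B) =
      piComparison G (fun _ : Fin n => A) ≫ Limits.Pi.map fun _ => G.map h := by
  apply Limits.Pi.hom_ext
  intro i
  rw [Category.assoc, Category.assoc, piComparison_comp_π, Limits.Pi.map_π,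
    piComparison_comp_π_assoc, ← G.map_comp, ← G.map_comp, Limits.Pi.map_π]

theorem app_comp_piComparison {G H : E ⥤ F} (α : G ⟶ H) (A : E) :
    α.app (∏ᶜ fun _ : Fin n => A) ≫ piComparison H (fun _ : Fin n => A) =
      piComparison G (fun _ : Fin n => A) ≫ Limits.Pi.map fun _ => α.app A := by
  apply Limits.Pi.hom_ext
  intro i
  rw [Category.assoc, Category.assoc, piComparison_comp_π, Limits.Pi.map_π,
    piComparison_comp_π_assoc, α.naturality]

theorem piComparison_comp {K : Type*} [Category* K] [HasFiniteLimits K] (H : F ⥤ K) (A : E) :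
    piComparison (G ⋙ H) (fun _ : Fin n => A) =
      H.map (piComparison G fun _ : Fin n => A) ≫ piComparison H fun _ : Fin n => G.obj A := by
  apply Limits.Pi.hom_ext
  intro i
  refine (piComparison_comp_π (G ⋙ H) (fun _ : Fin n => A) i).trans ?_
  refine Eq.trans ?_ (Category.assoc _ _ _).symm
  refine Eq.trans ?_ (congrArg (H.map (piComparison G fun _ : Fin n => A) ≫ ·)
    (piComparison_comp_π H (fun _ : Fin n => G.obj A) i)).symm
  exact (congrArg H.map (piComparison_comp_π G (fun _ : Fin n => A) i)).symm.trans (H.map_comp _ _)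

theorem map_comp_piComparison_comp {K : Type*} [Category* K] [HasFiniteLimits K] (H : F ⥤ K)
    {A B : E} (m : B ⟶ ∏ᶜ fun _ : Fin n => A) :
    (G ⋙ H).map m ≫ piComparison (G ⋙ H) (fun _ : Fin n => A) =
      H.map (G.map m ≫ piComparison G fun _ : Fin n => A) ≫
        piComparison H fun _ : Fin n => G.obj A := by
  rw [piComparison_comp, H.map_comp]
  exact (Category.assoc _ _ _).symm

variable [PreservesFiniteLimits G]

/-- The comparison map is invertible, so its inverse can be moved to the other side, where its
naturality in the object reduces the claim to the image of `w` under `G`. This makes images of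
homomorphisms respect operations. -/
theorem map_op_naturality {A B : E} (f : (∏ᶜ fun _ : Fin n => A) ⟶ A)
    (g : (∏ᶜ fun _ : Fin n => B) ⟶ B) (h : A ⟶ B) (w : f ≫ h = Limits.Pi.map (fun _ => h) ≫ g) :
    (inv (piComparison G fun _ : Fin n => A) ≫ G.map f) ≫ G.map h =
      Limits.Pi.map (fun _ => G.map h) ≫ inv (piComparison G fun _ : Fin n => B) ≫ G.map g := by
  rw [Category.assoc, IsIso.inv_comp_eq, ← G.map_comp, w, G.map_comp, ← Category.assoc,
    ← Category.assoc, ← map_piMap_comp_piComparison, Category.assoc, Category.assoc,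
    IsIso.hom_inv_id_assoc]

/-- The same argument, with naturality of the comparison map in the functor. -/
theorem app_op_naturality {G H : E ⥤ F} [PreservesFiniteLimits G] [PreservesFiniteLimits H]
    (α : G ⟶ H) {A : E} (f : (∏ᶜ fun _ : Fin n => A) ⟶ A) :
    (inv (piComparison G fun _ : Fin n => A) ≫ G.map f) ≫ α.app A =
      Limits.Pi.map (fun _ => α.app A) ≫ inv (piComparison H fun _ : Fin n => A) ≫ H.map f := by
  rw [Category.assoc, IsIso.inv_comp_eq, α.naturality, ← Category.assoc, ← Category.assoc,
    ← app_comp_piComparison, Category.assoc, Category.assoc, IsIso.hom_inv_id_assoc]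

end

variable (G : E ⥤ F) [PreservesFiniteLimits G]

/-- The image under `G` of a homomorphism of structures. -/
def SigStr.mapHom {M N : SigStr L E} (h : M ⟶ N) : M.map G ⟶ N.map G :=
  SigStr.Hom.mk (M := M.map G) (N := N.map G) (G.map (SigStr.Hom.hom h))
    (fun f => map_op_naturality G _ _ _ (SigStr.Hom.map_fun h f))
    fun {n} p => factors_mk_arrow_comp
      (G.map (M.rel p).arrow ≫ piComparison G fun _ : Fin n => M.carrier)
      (G.map (N.rel p).arrow ≫ piComparison G fun _ : Fin n => N.carrier)
      (f := Limits.Pi.map fun _ => G.map (SigStr.Hom.hom h))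
      (G.map ((N.rel p).factorThru _ (SigStr.Hom.map_rel h p))) (by
        rw [← Category.assoc, ← G.map_comp, Subobject.factorThru_arrow, G.map_comp, Category.assoc,
          Category.assoc, map_piMap_comp_piComparison])

/-- Functors preserving finite limits send isomorphic structures to isomorphic structures. -/
def SigStr.mapIso {M N : SigStr L E} (e : M ≅ N) : M.map G ≅ N.map G where
  hom := SigStr.mapHom G e.hom
  inv := SigStr.mapHom G e.inv
  hom_inv_id := SigStr.Hom.ext (by
    change G.map _ ≫ G.map _ = 𝟙 _
    rw [← G.map_comp, ← SigStr.comp_hom, e.hom_inv_id]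
    exact G.map_id _)
  inv_hom_id := SigStr.Hom.ext (by
    change G.map _ ≫ G.map _ = 𝟙 _
    rw [← G.map_comp, ← SigStr.comp_hom, e.inv_hom_id]
    exact G.map_id _)

/-- The component at a structure of a natural transformation between functors preserving finite
limits. -/
def SigStr.mapNatTrans {G H : E ⥤ F} [PreservesFiniteLimits G] [PreservesFiniteLimits H]
    (α : G ⟶ H) (M : SigStr L E) : M.map G ⟶ M.map H :=
  SigStr.Hom.mk (M := M.map G) (N := M.map H) (α.app M.carrier)
    (fun f => app_op_naturality α (M.funMap f))
    fun {n} p => factors_mk_arrow_comp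
      (G.map (M.rel p).arrow ≫ piComparison G fun _ : Fin n => M.carrier)
      (H.map (M.rel p).arrow ≫ piComparison H fun _ : Fin n => M.carrier)
      (f := Limits.Pi.map fun _ => α.app M.carrier) (α.app _) (by
        rw [← Category.assoc, ← α.naturality, Category.assoc, Category.assoc,
          app_comp_piComparison])

/-- Naturally isomorphic functors have isomorphic values at a structure. -/
def SigStr.mapNatIso {G H : E ⥤ F} [PreservesFiniteLimits G] [PreservesFiniteLimits H]
    (α : G ≅ H) (M : SigStr L E) : M.map G ≅ M.map H where
  hom := SigStr.mapNatTrans α.hom M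
  inv := SigStr.mapNatTrans α.inv M
  hom_inv_id := SigStr.Hom.ext (α.hom_inv_id_app M.carrier)
  inv_hom_id := SigStr.Hom.ext (α.inv_hom_id_app M.carrier)

/-- The image of a structure under a composite functor. -/
def SigStr.mapCompIso {K : Type*} [Category* K] [HasFiniteLimits K] (H : F ⥤ K)
    [PreservesFiniteLimits H] [PreservesFiniteLimits (G ⋙ H)] (M : SigStr L E) :
    (M.map G).map H ≅ M.map (G ⋙ H) :=
  -- The two carriers coincide definitionally and the isomorphism is the identity on them; what
  -- remains is to match the comparison maps of `G`, `H` and `G ⋙ H`.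
  have hid (n : ℕ) : (Limits.Pi.map fun _ : Fin n => 𝟙 (H.obj (G.obj M.carrier))) = 𝟙 _ :=
    Limits.Pi.map_id
  SigStr.isoMk (M := (M.map G).map H) (N := M.map (G ⋙ H)) (Iso.refl (H.obj (G.obj M.carrier)))
    (fun {n} f => by
      have key : inv (piComparison H fun _ : Fin n => G.obj M.carrier) ≫
          H.map (inv (piComparison G fun _ : Fin n => M.carrier) ≫ G.map (M.funMap f)) =
          inv (piComparison (G ⋙ H) fun _ : Fin n => M.carrier) ≫ (G ⋙ H).map (M.funMap f) := by
        rw [IsIso.eq_inv_comp, piComparison_comp]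
        refine (Category.assoc _ _ _).trans ?_
        rw [IsIso.hom_inv_id_assoc, ← H.map_comp, IsIso.hom_inv_id_assoc]
        rfl
      exact (Category.comp_id _).trans (key.trans ((Category.id_comp _).symm.trans
        (congrArg (· ≫ _) (hid n).symm))))
    (fun {n} p => by
      refine factors_mk_arrow_comp
        (H.map (Subobject.mk (G.map (M.rel p).arrow ≫
          piComparison G fun _ : Fin n => M.carrier)).arrow ≫
          piComparison H fun _ : Fin n => G.obj M.carrier)
        ((G ⋙ H).map (M.rel p).arrow ≫ piComparison (G ⋙ H) fun _ : Fin n => M.carrier)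
        (f := Limits.Pi.map fun _ => 𝟙 (H.obj (G.obj M.carrier)))
        -- The arrow of `Subobject.mk` belongs to a chosen representative; `underlyingIso` passes
        -- between it and the explicit monomorphism.
        (H.map (Subobject.underlyingIso _).hom) ?_
      refine Eq.trans ?_ ((Category.comp_id _).symm.trans (congrArg (_ ≫ ·) (hid n).symm))
      refine (congrArg (_ ≫ ·) (map_comp_piComparison_comp G H (M.rel p).arrow)).trans ?_
      rw [← Category.assoc, ← H.map_comp, Subobject.underlyingIso_hom_comp_eq_mk])
    (fun {n} p => by
      refine factors_mk_arrow_comp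
        ((G ⋙ H).map (M.rel p).arrow ≫ piComparison (G ⋙ H) fun _ : Fin n => M.carrier)
        (H.map (Subobject.mk (G.map (M.rel p).arrow ≫
          piComparison G fun _ : Fin n => M.carrier)).arrow ≫
          piComparison H fun _ : Fin n => G.obj M.carrier)
        (f := Limits.Pi.map fun _ => 𝟙 (H.obj (G.obj M.carrier)))
        (H.map (Subobject.underlyingIso _).inv) ?_
      refine Eq.trans ?_ ((Category.comp_id _).symm.trans (congrArg (_ ≫ ·) (hid n).symm))
      refine Eq.trans ?_ (map_comp_piComparison_comp G H (M.rel p).arrow).symm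
      rw [← Category.assoc, ← H.map_comp, Subobject.underlyingIso_arrow])

end

/-! ### Restriction of presheaf structures along a functor -/

section

variable {L : FirstOrder.Language.{u, u}}
variable {C D : Type u} [Category.{u} C] [Category.{u} D]

/-- The subpresheaf of `Pⁿ` that interprets an `n`-ary predicate symbol in `presheafStr`. -/
def relSubfunctor (P : Cᵒᵖ ⥤ Type u) {n : ℕ} (R : ∀ X, Set (Fin n → P.obj X))
    (hR : ∀ {X Y} (g : X ⟶ Y) (t : Fin n → P.obj X), t ∈ R X → (fun i => P.map g (t i)) ∈ R Y) :
    Subfunctor (∏ᶜ fun _ : Fin n => P) where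
  obj X := {z | (fun i => (Pi.π (fun _ : Fin n => P) i).app X z) ∈ R X}
  map {X Y} g := by
    intro z hz
    have := hR g _ hz
    simpa using! this

/-- A structure in presheaves on `D` restricts along `F : C ⥤ D` to a structure in presheaves on
`C`, up to an isomorphism of carriers that respects operations and relations objectwise. -/
def presheafStrRestrictIso (F : C ⥤ D) {P : Dᵒᵖ ⥤ Type u} {Q : Cᵒᵖ ⥤ Type u}
    {opP : ∀ {n : ℕ}, L.Functions n → ∀ X, (Fin n → P.obj X) → P.obj X} {opP_natural}
    {relP : ∀ {n : ℕ}, L.Relations n → ∀ X, Set (Fin n → P.obj X)} {relP_stable}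
    {opQ : ∀ {n : ℕ}, L.Functions n → ∀ X, (Fin n → Q.obj X) → Q.obj X} {opQ_natural}
    {relQ : ∀ {n : ℕ}, L.Relations n → ∀ X, Set (Fin n → Q.obj X)} {relQ_stable}
    (e : F.op ⋙ P ≅ Q)
    (he : ∀ {n : ℕ} (f : L.Functions n) (X : Cᵒᵖ) (t : Fin n → P.obj (F.op.obj X)),
      e.hom.app X (opP f (F.op.obj X) t) = opQ f X fun i => e.hom.app X (t i))
    (hrel : ∀ {n : ℕ} (p : L.Relations n) (X : Cᵒᵖ) (t : Fin n → P.obj (F.op.obj X)),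
      (fun i => e.hom.app X (t i)) ∈ relQ p X ↔ t ∈ relP p (F.op.obj X)) :
    (presheafStr P opP opP_natural relP relP_stable).map
      ((Functor.whiskeringLeft _ _ (Type u)).obj F.op) ≅
    presheafStr Q opQ opQ_natural relQ relQ_stable := by
  let W := (Functor.whiskeringLeft Cᵒᵖ Dᵒᵖ (Type u)).obj F.op
  -- The comparison `(Pⁿ)F ⟶ (PF)ⁿ ⟶ Qⁿ` acts on tuples as `e` does in each coordinate.
  have hπ (n : ℕ) (i : Fin n) (X : Cᵒᵖ) (z : (∏ᶜ fun _ : Fin n => P).obj (F.op.obj X)) :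
      (Pi.π (fun _ : Fin n => Q) i).app X ((Limits.Pi.map fun _ : Fin n => e.hom).app X
        ((piComparison W fun _ : Fin n => P).app X z)) =
      e.hom.app X ((Pi.π (fun _ : Fin n => P) i).app (F.op.obj X) z) := by
    have h : (piComparison W fun _ : Fin n => P) ≫ (Limits.Pi.map fun _ : Fin n => e.hom) ≫
        Pi.π (fun _ : Fin n => Q) i = W.map (Pi.π (fun _ : Fin n => P) i) ≫ e.hom := by
      refine (congrArg (_ ≫ ·) (Limits.Pi.map_π _ i)).trans ?_
      exact piComparison_comp_π_assoc _ _ _ _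
    exact ConcreteCategory.congr_hom (NatTrans.congr_app h X) z
  let RP {n : ℕ} (p : L.Relations n) := relSubfunctor P (relP p) (relP_stable p)
  let RQ {n : ℕ} (p : L.Relations n) := relSubfunctor Q (relQ p) (relQ_stable p)
  have hmem {n : ℕ} (p : L.Relations n) (X : Cᵒᵖ)
      (z : (∏ᶜ fun _ : Fin n => P).obj (F.op.obj X)) :
      (Limits.Pi.map fun _ : Fin n => e.hom).app X ((piComparison W fun _ : Fin n => P).app X z) ∈
        (RQ p).obj X ↔ z ∈ (RP p).obj (F.op.obj X) := by
    refine Iff.trans (Eq.to_iff (congrArg (· ∈ relQ p X) ?_)) (hrel p X _)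
    funext i
    exact hπ n i X z
  refine SigStr.isoMk e ?_ ?_ ?_
  · intro n f
    refine (Category.assoc _ _ _).trans
      ((IsIso.inv_comp_eq (piComparison W fun _ : Fin n => P)).2 ?_)
    ext X z
    refine (he f X _).trans (congrArg (opQ f X) ?_)
    funext i
    exact (hπ n i X z).symm
  · intro n p
    refine factors_mk_arrow_comp
      (W.map (Subobject.mk (RP p).ι).arrow ≫ piComparison W fun _ : Fin n => P) (RQ p).ι
      (f := Limits.Pi.map fun _ => e.hom)
      (W.map (Subobject.underlyingIso _).hom ≫ Subfunctor.lift (G := RQ p)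
        (W.map (RP p).ι ≫ (piComparison W fun _ : Fin n => P) ≫ Limits.Pi.map fun _ => e.hom) ?_) ?_
    · rintro X _ ⟨z, rfl⟩
      exact (hmem p X _).2 z.2
    · refine (Category.assoc _ _ _).trans ?_
      refine (congrArg (_ ≫ ·) (Subfunctor.lift_ι _ _)).trans ?_
      rw [← Category.assoc, ← W.map_comp,
        Subobject.underlyingIso_hom_comp_eq_mk, Category.assoc]
  · intro n p
    -- The restriction of `RP p` as a subfunctor, so that `Subfunctor.lift` applies; its underlying
    -- presheaf is definitionally `W.obj (RP p).toFunctor`.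
    let RW : Subfunctor (W.obj (∏ᶜ fun _ : Fin n => P)) :=
      { obj X := (RP p).obj (F.op.obj X)
        map g := (RP p).map (F.op.map g) }
    have hid : ((Limits.Pi.map fun _ : Fin n => e.inv) ≫
        inv (piComparison W fun _ : Fin n => P)) ≫ (piComparison W fun _ : Fin n => P) ≫
        (Limits.Pi.map fun _ : Fin n => e.hom) = 𝟙 _ := by
      refine (Category.assoc _ _ _).trans ?_
      refine (congrArg (_ ≫ ·) (IsIso.inv_hom_id_assoc _ _)).trans ?_
      rw [Limits.Pi.map_comp_map]
      refine Eq.trans ?_ Limits.Pi.map_id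
      exact congrArg (fun k => Limits.Pi.map fun _ : Fin n => k) e.inv_hom_id
    let l : (RQ p).toFunctor ⟶ W.obj (RP p).toFunctor := Subfunctor.lift (G := RW)
      ((RQ p).ι ≫ (Limits.Pi.map fun _ => e.inv) ≫ inv (piComparison W fun _ : Fin n => P)) (by
        rintro X _ ⟨z, rfl⟩
        -- By `hid`, transporting the preimage of `z` forward returns `z`, which satisfies the
        -- relation in `Q`.
        refine (hmem p X _).1 ?_
        have := ConcreteCategory.congr_hom (NatTrans.congr_app hid X) z.1
        exact this.symm ▸ z.2)
    have hl : l ≫ W.map (RP p).ι = (RQ p).ι ≫ (Limits.Pi.map fun _ => e.inv) ≫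
      inv (piComparison W fun _ : Fin n => P) := rfl
    refine factors_mk_arrow_comp (RQ p).ι
      (W.map (Subobject.mk (RP p).ι).arrow ≫ piComparison W fun _ : Fin n => P)
      (f := Limits.Pi.map fun _ => e.inv) (l ≫ W.map (Subobject.underlyingIso _).inv) ?_
    rw [Category.assoc, ← Category.assoc (W.map _), ← W.map_comp, Subobject.underlyingIso_arrow,
      ← Category.assoc, hl, Category.assoc]
    refine congrArg (_ ≫ ·) ?_
    exact (Category.assoc _ _ _).trans ((congrArg (_ ≫ ·) (IsIso.inv_hom_id _)).trans
      (Category.comp_id _))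

end

/-! ### Inverse images of associated sheaves along comorphisms of sites -/

section

variable {L : FirstOrder.Language.{u, u}}
variable {C D : Type u} [Category.{u} C] [Category.{u} D] (F : C ⥤ D)
  (J : GrothendieckTopology C) (K : GrothendieckTopology D) (hF : F.IsCocontinuous J K)

/-- The inverse image of the sheaf associated with `P` is the sheaf associated with the restriction
of `P` along the comorphism. -/
def sheafifyInverseImageIso :
    presheafToSheaf K (Type u) ⋙ (comorphismGeom F J K hF).inverseImage ≅
      (Functor.whiskeringLeft _ _ (Type u)).obj F.op ⋙ presheafToSheaf J (Type u) :=
  -- Both right adjoints send a sheaf on `C` to the right Kan extension of its underlying presheaf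
  -- along `F`; cover lifting makes this a sheaf.
  Adjunction.leftAdjointUniq
    ((sheafificationAdjunction K (Type u)).comp (comorphismGeom F J K hF).adj)
    ((F.op.ranAdjunction (Type u)).comp (sheafificationAdjunction J (Type u)))

/-- If the restriction of `M` along the comorphism is `N`, then the inverse image of the structure
associated with `M` is the structure associated with `N`. -/
def canonicalInverseImageIso {M : SigStr L (Dᵒᵖ ⥤ Type u)} {N : SigStr L (Cᵒᵖ ⥤ Type u)}
    (e : M.map ((Functor.whiskeringLeft _ _ (Type u)).obj F.op) ≅ N) :
    (M.map (presheafToSheaf K (Type u))).map (comorphismGeom F J K hF).inverseImage ≅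
      N.map (presheafToSheaf J (Type u)) :=
  SigStr.mapCompIso _ _ M ≪≫ SigStr.mapNatIso (sheafifyInverseImageIso F J K hF) M ≪≫
    (SigStr.mapCompIso _ _ M).symm ≪≫ SigStr.mapIso _ e

end

variable {L : FirstOrder.Language.{u, u}} {T : CoherentTheory L} {X Y : Finset ℕ}

/-! ### Equality theory without equations -/

/-- Atoms alone entail only themselves and trivial equations. -/
theorem Entails.of_atoms {α : Type} {A : Set (Atom L α)} {φ : EqFact L α}
    (h : Entails (EqFact.atom '' A) φ) :
    match φ with
    | .atom a => a ∈ A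
    | .eq s t => s = t := by
  -- Syntactic equality together with membership in `A` is closed under every rule; congruence for
  -- predicates becomes rewriting along equal arguments.
  induction h with
  | hyp h =>
    obtain ⟨a, ha, rfl⟩ := h
    exact ha
  | refl => rfl
  | symm _ ih => exact ih.symm
  | trans _ _ ih₁ ih₂ => exact ih₁.trans ih₂
  | func f _ ih => exact congrArg _ (funext ih)
  | rel p _ _ ih₁ ih₂ => exact funext ih₁ ▸ ih₂

theorem Entails.of_eq {α : Type} {A : Set (EqFact L α)} {s t : L.Term α} (h : s = t) :
    Entails A (.eq s t) :=
  h ▸ .refl s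

theorem entails_atoms_eq_iff {α : Type} {A : Set (Atom L α)} {s t : L.Term α} :
    Entails (EqFact.atom '' A) (.eq s t) ↔ s = t :=
  ⟨fun h => h.of_atoms, .of_eq⟩

theorem entails_atoms_atom_iff {α : Type} {A : Set (Atom L α)} {a : Atom L α} :
    Entails (EqFact.atom '' A) (.atom a) ↔ a ∈ A :=
  ⟨fun h => h.of_atoms, fun h => .hyp ⟨a, h, rfl⟩⟩

/-! ### Reindexing instances of axioms -/

namespace AxiomInstance

/-- The instance of the same axiom over `Y` obtained by applying a substitution to the instantiating
terms, with new names for the bound variables. -/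
def reindex (I : AxiomInstance T X) (σ : X → L.Term Y) : AxiomInstance T Y where
  ax := I.ax
  mem := I.mem
  inst j := (I.inst j).subst σ
  -- The old names may occur in `Y`, so the new ones start above its maximum. Different disjuncts
  -- may share names, as each extends the condition separately.
  fresh i := ⟨fun j => j + (Y.sup id + 1), fun j k h => Fin.ext (by simpa using h)⟩
  fresh_notMem i j h := by
    have : (j : ℕ) + (Y.sup id + 1) ≤ Y.sup id := Finset.le_sup (f := id) h
    omega

variable (I : AxiomInstance T X) (σ : X → L.Term Y)

/-- The name of an existentially bound variable, as an element of `X, x⃗ᵢ`. -/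
def freshVar (i : Fin I.ax.numDisj) (j : Fin (I.ax.numEx i)) : I.vars i :=
  ⟨I.fresh i j, Finset.mem_union_right _ (Finset.mem_map_of_mem _ (Finset.mem_univ j))⟩

theorem mem_vars_cases (i : Fin I.ax.numDisj) (x : I.vars i) :
    x.1 ∈ X ∨ ∃ j, x = I.freshVar i j := by
  obtain ⟨x, hx⟩ := x
  rcases Finset.mem_union.1 hx with h | h
  · exact .inl h
  · obtain ⟨j, -, rfl⟩ := Finset.mem_map.1 h
    exact .inr ⟨j, rfl⟩

/-- The extension of a substitution `σ : X → Tm(Y)` to the bound variables of an instance. -/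
def liftSub (i : Fin I.ax.numDisj) (x : I.vars i) : L.Term ((I.reindex σ).vars i) :=
  open Classical in
  if h : x.1 ∈ X then (σ ⟨x, h⟩).subst ((I.reindex σ).incl i)
  else if h' : ∃ j, x = I.freshVar i j then .var ((I.reindex σ).freshVar i h'.choose)
  -- This case is impossible: every variable lies in `X` or is bound.
  else False.elim ((I.mem_vars_cases i x).elim h h')

theorem liftSub_of_mem (i : Fin I.ax.numDisj) (x : X) :
    I.liftSub σ i ⟨x, Finset.mem_union_left _ x.2⟩ = (σ x).subst ((I.reindex σ).incl i) := by
  simp [liftSub]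

/-- Freshness excludes the first branch of `liftSub`, and injectivity of `fresh i` forces the chosen
index to be `j`. -/
theorem liftSub_freshVar (i : Fin I.ax.numDisj) (j : Fin (I.ax.numEx i)) :
    I.liftSub σ i (I.freshVar i j) = .var ((I.reindex σ).freshVar i j) := by
  have h' : ∃ k, I.freshVar i j = I.freshVar i k := ⟨j, rfl⟩
  have hj : h'.choose = j := (I.fresh i).injective (congrArg Subtype.val h'.choose_spec).symm
  exact (dif_neg (I.fresh_notMem i j)).trans ((dif_pos h').trans (hj.symm ▸ rfl))

theorem incl_subst_liftSub (i : Fin I.ax.numDisj) (x : X) :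
    (I.incl i x).subst (I.liftSub σ i) = (σ x).subst ((I.reindex σ).incl i) :=
  I.liftSub_of_mem σ i x

theorem subst_incl_subst_liftSub (i : Fin I.ax.numDisj) (a : Atom L X) :
    (a.subst (I.incl i)).subst (I.liftSub σ i) = (a.subst σ).subst ((I.reindex σ).incl i) :=
  (Atom.subst_subst _ _ _).trans ((congrArg a.subst (funext (I.incl_subst_liftSub σ i))).trans
    (Atom.subst_subst _ _ _).symm)

theorem eqFact_subst_incl_subst_liftSub (i : Fin I.ax.numDisj) (a : EqFact L X) :
    (a.subst (I.incl i)).subst (I.liftSub σ i) = (a.subst σ).subst ((I.reindex σ).incl i) :=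
  (EqFact.subst_subst _ _ _).trans ((congrArg (fun τ => a.subst τ)
    (funext (I.incl_subst_liftSub σ i))).trans (EqFact.subst_subst _ _ _).symm)

/-- This makes the extended substitution carry each conclusion `φᵢ` of the instance to that of the
reindexed instance: terms for universal variables are substituted, bound variables are renamed. -/
theorem conclInst_subst_liftSub (i : Fin I.ax.numDisj) (x) :
    (I.conclInst i x).subst (I.liftSub σ i) = (I.reindex σ).conclInst i x := by
  rcases x with j | j
  · change ((I.inst j).subst (I.incl i)).subst (I.liftSub σ i) =
      ((I.inst j).subst σ).subst ((I.reindex σ).incl i)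
    simp only [term_subst_subst, incl_subst_liftSub]
  · exact I.liftSub_freshVar σ i j

theorem subst_mem_concl_reindex (i : Fin I.ax.numDisj) {a : Atom L (I.vars i)}
    (ha : a ∈ I.concl i) : a.subst (I.liftSub σ i) ∈ (I.reindex σ).concl i := by
  obtain ⟨b, hb, rfl⟩ := ha
  exact ⟨b, hb, (Atom.subst_subst _ _ _).trans
    (congrArg b.subst (funext (I.conclInst_subst_liftSub σ i)))⟩

theorem hyp_reindex_subset {A : Set (Atom L Y)} (h : ∀ a ∈ I.hyp, a.subst σ ∈ A) :
    (I.reindex σ).hyp ⊆ A := by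
  rintro _ ⟨b, hb, rfl⟩
  exact Atom.subst_subst b I.inst σ ▸ h _ ⟨b, hb, rfl⟩

/-! ### Lifting morphisms to the extended conditions. -/

variable {P Q : Cond L}

/-- The lift of a morphism `P ⟶ Q` of `C_ts` to the conditions that extend `P` and `Q` by the
conclusion of an instance. -/
def liftHom (g : P ⟶ Q) (I : AxiomInstance T Q.vars) (i : Fin I.ax.numDisj) :
    (I.reindex (Cond.Hom.sub g)).ext i ⟶ I.ext i :=
  Cond.Hom.mk (P := (I.reindex (Cond.Hom.sub g)).ext i) (Q := I.ext i) (I.liftSub _ i) (by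
    rintro _ (⟨a, ha, rfl⟩ | ha)
    · exact .inl ⟨_, Cond.Hom.map_facts g a ha, (I.subst_incl_subst_liftSub _ i a).symm⟩
    · exact .inr (I.subst_mem_concl_reindex _ i ha))

/-- The commuting square by which the pulled-back family is refined by the reindexed one. -/
theorem liftHom_comp_proj (g : P ⟶ Q) (I : AxiomInstance T Q.vars) (i : Fin I.ax.numDisj) :
    liftHom g I i ≫ I.proj i = (I.reindex (Cond.Hom.sub g)).proj i ≫ g :=
  Cond.Hom.ext (funext fun x => I.incl_subst_liftSub _ i x)

/-- Bound variables go to bound variables, and on the old ones the lift is `g` followed by an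
inclusion. -/
theorem isVarSubst_liftHom {g : P ⟶ Q} (hg : isVarSubst L g) (I : AxiomInstance T Q.vars)
    (i : Fin I.ax.numDisj) : isVarSubst L (liftHom g I i) := by
  obtain ⟨g', hg'⟩ := hg
  have : ∀ x : I.vars i, ∃ y, I.liftSub (Cond.Hom.sub g) i x = .var y := by
    intro x
    rcases I.mem_vars_cases i x with h | ⟨j, rfl⟩
    · refine ⟨⟨g' ⟨x, h⟩, Finset.mem_union_left _ (g' ⟨x, h⟩).2⟩, ?_⟩
      rw [I.liftSub_of_mem _ i ⟨x, h⟩, hg']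
      rfl
    · exact ⟨_, I.liftSub_freshVar _ i j⟩
  choose y hy using this
  exact ⟨y, hy⟩

/-- The lift of a morphism `P ⟶ Q` of `C⁰`, where `P` contains no equations. -/
def liftHomEq {Q : CondEq L} (g : CondEq.PreHom P.toEq Q) (I : AxiomInstance T Q.vars)
    (i : Fin I.ax.numDisj) : ((I.reindex (Y := P.vars) g.sub).ext (P := P) i).toEq ⟶ I.extEq i :=
  Quotient.mk (CondEq.setoid ((I.reindex (Y := P.vars) g.sub).ext (P := P) i).toEq (I.extEq i))
    ⟨I.liftSub (Y := P.vars) g.sub i, by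
      rintro _ (⟨a, ha, rfl⟩ | ⟨a, ha, rfl⟩)
      -- A fact of `Q`, possibly an equation, is provable over `P` after substitution; the proof is
      -- transported along the inclusion of variables.
      · refine (I.eqFact_subst_incl_subst_liftSub (Y := P.vars) g.sub i a).symm ▸
          Entails.subst ?_ (g.map_facts a ha)
        rintro _ ⟨b, hb, rfl⟩
        exact .hyp ⟨_, .inl ⟨b, hb, rfl⟩, rfl⟩
      · exact .hyp ⟨_, .inr (I.subst_mem_concl_reindex _ i ha), rfl⟩⟩

theorem liftHomEq_comp_projEq {Q : CondEq L} (g : CondEq.PreHom P.toEq Q)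
    (I : AxiomInstance T Q.vars) (i : Fin I.ax.numDisj) :
    liftHomEq g I i ≫ I.projEq i =
      (tsToEq L).map ((I.reindex (Y := P.vars) g.sub).proj i) ≫
        (Quotient.mk (CondEq.setoid P.toEq Q) g : P.toEq ⟶ Q) :=
  Quotient.sound fun x => Entails.of_eq (I.incl_subst_liftSub (Y := P.vars) g.sub i x)

end AxiomInstance

/-! ### The canonical functors are faithful comorphisms of sites -/

theorem tsToEq_faithful (L : FirstOrder.Language.{u, u}) : (tsToEq L).Faithful where
  map_injective {_ _} f g h := Cond.Hom.ext (funext fun x =>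
    entails_atoms_eq_iff.1 ((show ∀ y, Entails _ (.eq (Cond.Hom.sub f y) (Cond.Hom.sub g y)) from
      Quotient.exact h) x))

/-- The covering morphisms `eᵢ` are renamings, but the lift of `g` need not be one: the
factorization is only required in `C_vs`. -/
theorem rnToVs_isCocontinuous (T : CoherentTheory L) :
    (rnToVs L).IsCocontinuous (topRn T) (topVs T) := by
  refine Families.isCocontinuous _ _ _ fun P Q g I => ?_
  let a : (familiesRn T).index P := ⟨I.1.reindex (Cond.Hom.sub g.hom),
    I.1.hyp_reindex_subset _ fun a ha => Cond.Hom.map_facts g.hom a (I.2 ha)⟩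
  refine (topRn T).superset_covering ?_ ((familiesRn T).generate_mem_topology a)
  rw [Sieve.generate_le_iff]
  rintro _ _ ⟨i⟩
  refine ⟨_, ⟨AxiomInstance.liftHom g.hom I.1 i,
    AxiomInstance.isVarSubst_liftHom g.property I.1 i⟩, _, ⟨i⟩, ?_⟩
  ext : 1
  exact AxiomInstance.liftHom_comp_proj g.hom I.1 i

theorem vsToTs_isCocontinuous (T : CoherentTheory L) :
    (vsToTs L).IsCocontinuous (topVs T) (topTs T) := by
  refine Families.isCocontinuous _ _ _ fun P Q g I => ?_
  let a : (familiesVs T).index P := ⟨I.1.reindex (Cond.Hom.sub g),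
    I.1.hyp_reindex_subset _ fun a ha => Cond.Hom.map_facts g a (I.2 ha)⟩
  refine (topVs T).superset_covering ?_ ((familiesVs T).generate_mem_topology a)
  rw [Sieve.generate_le_iff]
  rintro _ _ ⟨i⟩
  exact ⟨_, AxiomInstance.liftHom g I.1 i, _, ⟨i⟩, AxiomInstance.liftHom_comp_proj g I.1 i⟩

theorem tsToEq_isCocontinuous (T : CoherentTheory L) :
    (tsToEq L).IsCocontinuous (topTs T) (topEq T) := by
  refine Families.isCocontinuous _ _ _ fun P Q g I => ?_
  induction g using Quotient.inductionOn with | _ g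
  let a : (familiesTs T).index P := ⟨I.1.reindex (Y := P.vars) g.sub,
    I.1.hyp_reindex_subset _ fun a ha =>
      -- The substituted hypotheses are provable from the atoms of `P`, hence already among them.
      entails_atoms_atom_iff.1 (g.map_facts _ (I.2 ⟨a, ha, rfl⟩))⟩
  refine (topTs T).superset_covering ?_ ((familiesTs T).generate_mem_topology a)
  rw [Sieve.generate_le_iff]
  rintro _ _ ⟨i⟩
  exact ⟨_, AxiomInstance.liftHomEq g I.1 i, _, ⟨i⟩, AxiomInstance.liftHomEq_comp_projEq g I.1 i⟩

/-! ### The presheaves of terms -/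

/-- The presheaf of terms on `C_vs` restricts to that on `C_rn`. -/
def tmVsRestrictIso (L : FirstOrder.Language.{u, u}) :
    (tmVs L).map ((Functor.whiskeringLeft _ _ (Type u)).obj (rnToVs L).op) ≅ tmRn L :=
  presheafStrRestrictIso (rnToVs L) (NatIso.ofComponents fun _ => Iso.refl _)
    (fun _ _ _ => rfl) fun _ _ _ => Iff.rfl

/-- The presheaf of terms on `C_ts` restricts to that on `C_vs`. -/
def tmTsRestrictIso (L : FirstOrder.Language.{u, u}) :
    (tmTs L).map ((Functor.whiskeringLeft _ _ (Type u)).obj (vsToTs L).op) ≅ tmVs L :=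
  presheafStrRestrictIso (vsToTs L) (NatIso.ofComponents fun _ => Iso.refl _)
    (fun _ _ _ => rfl) fun _ _ _ => Iff.rfl

theorem termHom_injective (P : Cond L) : Function.Injective (termHom (P := P.toEq)) :=
  fun _ _ h => entails_atoms_eq_iff.1 (termHom_eq_iff.1 h)

/-- Over a condition without equations, morphisms to `(x;)` are terms. -/
def homPointEquiv (P : Cond L) : (P.toEq ⟶ pointEq L) ≃ L.Term P.vars where
  toFun := termOf
  invFun := termHom (P := P.toEq)
  left_inv := termHom_termOf
  right_inv _ := termHom_injective P (termHom_termOf _)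

/-- The presheaf represented by `(x;)` on `C⁰` restricts to the presheaf of terms on `C_ts`. -/
def yoPointRestrictIso (L : FirstOrder.Language.{u, u}) :
    (yoPoint L).map ((Functor.whiskeringLeft _ _ (Type u)).obj (tsToEq L).op) ≅ tmTs L :=
  presheafStrRestrictIso (tsToEq L)
    (NatIso.ofComponents (fun X => (homPointEquiv X.unop).toIso) fun {X Y} g => by
      ext t
      -- `termOf` chooses representatives, so naturality is checked on classes, where injectivity of
      -- `termHom` loses nothing.
      refine termHom_injective Y.unop ((termHom_termOf _).trans ?_)
      obtain ⟨s, rfl⟩ := (homPointEquiv X.unop).symm.surjective t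
      refine Eq.trans ?_ (congrArg (fun s => termHom (P := Y.unop.toEq) (s.subst g.unop.sub))
        ((homPointEquiv X.unop).apply_symm_apply s).symm)
      rfl)
    (fun f X t => (homPointEquiv X.unop).apply_symm_apply _) fun p X t => by
      constructor
      · exact fun h => ⟨_, fun i => (termHom_termOf (t i)).symm, .hyp ⟨_, h, rfl⟩⟩
      · rintro ⟨s, hs, h⟩
        obtain rfl := funext hs
        -- Without equations a class contains only one term, so the witnesses `s` are the chosen
        -- representatives.
        have : (fun i => homPointEquiv X.unop (termHom (P := X.unop.toEq) (s i))) = s :=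
          funext fun i => (homPointEquiv X.unop).apply_symm_apply _
        change Atom.mk p (fun i => homPointEquiv X.unop (termHom (P := X.unop.toEq) (s i))) ∈ X.unop.facts
        rw [this]
        exact entails_atoms_atom_iff.1 h

end SynForcing

end

open SynForcing in
theorem mainTheorem9 (L : FirstOrder.Language.{u, u}) (T : CoherentTheory L) :
    (rnToVs L).Faithful ∧ (vsToTs L).Faithful ∧ (tsToEq L).Faithful ∧
    ∃ (hi : (rnToVs L).IsCocontinuous (topRn T) (topVs T))
      (hj : (vsToTs L).IsCocontinuous (topVs T) (topTs T))
      (hk : (tsToEq L).IsCocontinuous (topTs T) (topEq T)),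
      Nonempty ((canonVs T).map (comorphismGeom _ _ _ hi).inverseImage ≅ canonRn T) ∧
      Nonempty ((canonTs T).map (comorphismGeom _ _ _ hj).inverseImage ≅ canonVs T) ∧
      Nonempty ((canonEq T).map (comorphismGeom _ _ _ hk).inverseImage ≅ canonTs T) :=
  ⟨inferInstance, inferInstance, tsToEq_faithful L, rnToVs_isCocontinuous T,
    vsToTs_isCocontinuous T, tsToEq_isCocontinuous T,
    ⟨canonicalInverseImageIso _ _ _ _ (tmVsRestrictIso L)⟩,
    ⟨canonicalInverseImageIso _ _ _ _ (tmTsRestrictIso L)⟩,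
    ⟨canonicalInverseImageIso _ _ _ _ (yoPointRestrictIso L)⟩⟩
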